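/- Let $q$ be an odd prime, let $m\ge 4$, let $\mathrm{Tr}$ be the trace from $\mathrm{GF}(q^m)$ to $\mathrm{GF}(q)$, and let $\eta'$ and $\eta$ be the quadratic characters of $\mathrm{GF}(q^m)$ and $\mathrm{GF}(q)$ (with value $0$ at $0$). Put $\delta_2=(q-1)q^{m-1}-1-q^{\lfloor (m-1)/2\rfloor}$. For $a,b\in\mathrm{GF}(q^m)$ let $$\mathbf{c}_{(a,b)}=\Big(\mathrm{Tr}\big(ax^{1+q^{\lfloor (m-1)/2\rfloor+1}}+bx\big)\Big)_{x\in \mathrm{GF}(q^m)^*},$$ and let $\tilde{\mathcal C}_{\delta_2}=\{\mathbf{c}_{(a,b)} : a,b\in \mathrm{GF}(q^m)\}$, a linear code over $\mathrm{GF}(q)$. Then the minimum (nonzero) Hamming weight of $\tilde{\mathcal C}_{\delta_2}$ is $\delta_2+1$, and its codewords of minimum weight are characterized as follows. 1. Let $m$ be odd. For all $a,b\in\mathrm{GF}(q^m)$ with $a\ne 0$ the equation $$a^{q^{(m+1)/2}}x^{q}+ax+b^{q^{(m+1)/2}}=0$$ has a unique solution $x_0\in\mathrm{GF}(q^m)$.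 For all $a,b\in\mathrm{GF}(q^m)$, the codeword $\mathbf{c}_{(a,b)}$ has weight $\delta_2+1$ if and only if $ab\neq 0$ and, with this $x_0$, - $\eta'(-a)\,\eta\big(\mathrm{Tr}(a x_0^{1+q^{(m+1)/2}})\big)=1$, in the case $q\equiv 1\pmod 4$; - $\iota^{3m+3}\,\eta'(-a)\,\eta\big(\mathrm{Tr}(a x_0^{1+q^{(m+1)/2}})\big)=1$ with $\iota=\sqrt{-1}$, in the case $q\equiv 3\pmod 4$. 2. Let $m$ be even. For all $a,b\in\mathrm{GF}(q^m)$, the codeword $\mathbf{c}_{(a,b)}$ has weight $\delta_2+1$ if and only if $a^{q^{m/2}}+a\neq 0$, $b\neq 0$ and $$\mathrm{Tr}\left(\frac{ab^{1+q^{m/2}}}{(a^{q^{m/2}}+a)^2}\right)\neq 0.$$ -/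

import Mathlib

/-- The number `δ₂ = (q - 1) q ^ (m - 1) - 1 - q ^ ⌊(m - 1) / 2⌋`. -/
def delta2 (q m : ℕ) : ℕ := (q - 1) * q ^ (m - 1) - 1 - q ^ ((m - 1) / 2)

/-- The codeword `c_(a,b) = (Tr (a x ^ (1 + q ^ (⌊(m - 1) / 2⌋ + 1)) + b x))`, indexed by the nonzero
elements `x` of the field `K` (which plays the role of `GF(q ^ m)`). Here `Tr` is the trace
from `K` to `GF(q)`. -/
noncomputable def codeword (q m : ℕ) (K : Type*) [Field K] [Algebra (ZMod q) K] (a b : K) :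
    Kˣ → ZMod q :=
  fun x => Algebra.trace (ZMod q) K (a * (x : K) ^ (1 + q ^ ((m - 1) / 2 + 1)) + b * (x : K))

/-- The code consisting of all the codewords `c_(a,b)`, as a linear code over `GF(q)`. -/
noncomputable def codeDelta2 (q m : ℕ) (K : Type*) [Field K] [Algebra (ZMod q) K] :
    Submodule (ZMod q) (Kˣ → ZMod q) where
  carrier := {c | ∃ a b : K, c = codeword q m K a b}
  add_mem' := by
    rintro _ _ ⟨a, b, rfl⟩ ⟨a', b', rfl⟩
    refine ⟨a + a', b + b', ?_⟩
    funext x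
    simp only [codeword, Pi.add_apply, ← map_add]
    congr 1
    ring
  zero_mem' := ⟨0, 0, by funext x; simp [codeword]⟩
  smul_mem' := by
    rintro r _ ⟨a, b, rfl⟩
    refine ⟨r • a, r • b, ?_⟩
    funext x
    simp only [codeword, Pi.smul_apply, ← map_smul, smul_add, smul_mul_assoc]

/-! The weight of a codeword is q^m minus the number of zeros of Q(x) + Tr(bx), where Q(x) = Tr(a
x^(1+q^h)) and h = ⌊(m-1)/2⌋ + 1, so minimum weight means most zeros. Translating by a solution x₀
of a^(q^h) x₀^(q^(2h)) + a x₀ + b^(q^h) = 0 completes the square: the zeros correspond to the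
representations of c = Q(x₀) by Q (`zeroCount_eq_formCount`). These are counted through the sums of
ψ(t Q(x)) over x, with ψ the standard additive character of GF(q).

For m = 2h, x^(1+q^h) is the norm to GF(q^h). Either a^(q^h) + a = 0 and Q vanishes, or every sum
with t ≠ 0 equals -q^h, and exactly the nonzero c have the larger count (`formCount_even`).

For m = 2h - 1 and a ≠ 0, x^(1+q^h) is distributed like x^2, and the trace form has square
discriminant. The sums with t ≠ 0 are therefore η'(a) η(t) g^m, with g the quadratic Gauss sum of
GF(q). The count differs from q^(m-1) by ε q^((m-1)/2) with ε in {0, 1, -1} (`formCount_odd`); the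
maximum is ε = 1. -/

open scoped Classical in
/-- Counting the solutions of `f x = c` by additive characters. -/
theorem card_mul_card_fiber {q : ℕ} [Fact q.Prime] {X : Type*} [Fintype X] (f : X → ZMod q)
    (c : ZMod q) :
    (q : ℂ) * (Finset.univ.filter fun x => f x = c).card =
      ∑ t : ZMod q, ZMod.stdAddChar (-(t * c)) * ∑ x, ZMod.stdAddChar (t * f x) := by
  simp_rw [Finset.mul_sum, ← AddChar.map_add_eq_mul]
  rw [Finset.sum_comm]
  have h : ∀ x, ∑ t : ZMod q, ZMod.stdAddChar (-(t * c) + t * f x) =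
      if f x = c then (q : ℂ) else 0 := fun x => by
    have := AddChar.sum_mulShift (f x - c) (ZMod.isPrimitive_stdAddChar q)
    rw [ZMod.card] at this
    simp_rw [sub_eq_zero] at this
    rw [Nat.cast_ite, Nat.cast_zero] at this
    rw [← this]
    exact Finset.sum_congr rfl fun t _ => by congr 1; ring
  simp_rw [h]
  rw [← Finset.sum_filter, Finset.sum_const, nsmul_eq_mul, mul_comm]

/-- The complex-valued quadratic character of a finite field. -/
noncomputable def complexQuadraticChar (F : Type*) [Field F] [Fintype F] [DecidableEq F] :
    MulChar F ℂ :=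
  (quadraticChar F).ringHomComp (Int.castRingHom ℂ)

theorem complexQuadraticChar_apply {F : Type*} [Field F] [Fintype F] [DecidableEq F] (a : F) :
    complexQuadraticChar F a = (quadraticChar F a : ℂ) := rfl

theorem complexQuadraticChar_ne_one {F : Type*} [Field F] [Fintype F] [DecidableEq F]
    (hF : ringChar F ≠ 2) : complexQuadraticChar F ≠ 1 :=
  (MulChar.ringHomComp_ne_one_iff (RingHom.injective_int _)).mpr (quadraticChar_ne_one hF)

theorem complexQuadraticChar_isQuadratic {F : Type*} [Field F] [Fintype F] [DecidableEq F] :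
    (complexQuadraticChar F).IsQuadratic :=
  (quadraticChar_isQuadratic F).comp _

/-- The quadratic exponential sum with coefficient `a` equals a Gauss sum. -/
theorem sum_addChar_mul_sq {F : Type*} [Field F] [Fintype F] [DecidableEq F]
    (hF : ringChar F ≠ 2) {ψ : AddChar F ℂ} (hψ : ψ ≠ 1) {a : F} (ha : a ≠ 0) :
    ∑ x, ψ (a * x ^ 2) =
      complexQuadraticChar F a * gaussSum (complexQuadraticChar F) ψ := by
  have hprim := AddChar.IsPrimitive.of_ne_one hψ
  -- Each y has 1 + η(y) square roots.
  have h1 : ∑ x, ψ (a * x ^ 2) = ∑ y, ((quadraticChar F y : ℂ) + 1) * ψ (a * y) := by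
    rw [← Finset.sum_fiberwise (s := Finset.univ) (g := fun x : F => x ^ 2)]
    refine Finset.sum_congr rfl fun y _ => ?_
    have h := quadraticChar_card_sqrts hF y
    rw [Finset.sum_congr rfl (g := fun _ => ψ (a * y)), Finset.sum_const, nsmul_eq_mul]
    · have h' := congrArg (Int.cast : ℤ → ℂ) h
      push_cast at h'
      rw [← h']
      congr 3
      ext x
      simp
    · intro x hx
      rw [(Finset.mem_filter.mp hx).2]
  have h2 : ∑ y, ψ (a * y) = 0 := by
    have := AddChar.sum_mulShift a hprim
    simpa [ha, mul_comm] using this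
  rw [h1]
  simp_rw [add_mul, one_mul]
  rw [Finset.sum_add_distrib, h2, add_zero]
  have h3 := gaussSum_mulShift (complexQuadraticChar F) ψ (Units.mk0 a ha)
  rw [← h3, ← mul_assoc, Units.val_mk0, ← map_mul, ← pow_two]
  rw [show complexQuadraticChar F (a ^ 2) = 1 by
    rw [complexQuadraticChar_apply, quadraticChar_sq_one' ha, Int.cast_one], one_mul]
  rfl

/-! ### Frobenius powers, the trace and its characters -/

section FrobeniusPowers

variable {q : ℕ} [Fact q.Prime] {K : Type*} [Field K] [Algebra (ZMod q) K]

theorem add_pow_prime_pow (x y : K) (k : ℕ) : (x + y) ^ q ^ k = x ^ q ^ k + y ^ q ^ k := by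
  have : CharP K q := charP_of_injective_algebraMap' (ZMod q) q
  exact add_pow_char_pow ..

theorem sub_pow_prime_pow (x y : K) (k : ℕ) : (x - y) ^ q ^ k = x ^ q ^ k - y ^ q ^ k := by
  have : CharP K q := charP_of_injective_algebraMap' (ZMod q) q
  exact sub_pow_char_pow ..

theorem algebraMap_pow_prime_pow (t : ZMod q) (k : ℕ) :
    algebraMap (ZMod q) K t ^ q ^ k = algebraMap (ZMod q) K t := by
  rw [← map_pow, ZMod.pow_card_pow]

theorem ringChar_ne_two_of_algebra (hq : q ≠ 2) : ringChar K ≠ 2 := by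
  have : CharP K q := charP_of_injective_algebraMap' (ZMod q) q
  rwa [ringChar.eq K q]

variable [Fintype K]

omit [Fintype K] in
theorem pow_prime_pow_injective (k : ℕ) : Function.Injective fun x : K => x ^ q ^ k := by
  intro x y h
  have h' : (x - y) ^ q ^ k = 0 := by rw [sub_pow_prime_pow]; exact sub_eq_zero.mpr h
  exact sub_eq_zero.mp (pow_eq_zero_iff (pow_ne_zero _ (Fact.out : q.Prime).ne_zero) |>.mp h')

theorem pow_prime_pow_surjective (k : ℕ) : Function.Surjective fun x : K => x ^ q ^ k :=
  Finite.surjective_of_injective (pow_prime_pow_injective k)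

theorem trace_pow_prime_pow (x : K) (k : ℕ) :
    Algebra.trace (ZMod q) K (x ^ q ^ k) = Algebra.trace (ZMod q) K x := by
  induction k with
  | zero => simp
  | succ k ih =>
    rw [pow_succ, pow_mul, ← ih]
    have := Algebra.trace_eq_of_algEquiv
      (FiniteField.frobeniusAlgEquivOfAlgebraic (ZMod q) K) (x ^ q ^ k)
    rwa [FiniteField.coe_frobeniusAlgEquivOfAlgebraic, ZMod.card] at this

variable (q) in
theorem card_eq_prime_pow {m : ℕ} (hK : Module.finrank (ZMod q) K = m) :
    Fintype.card K = q ^ m := by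
  rw [Module.card_eq_pow_finrank (K := ZMod q), ZMod.card, hK]

theorem pow_card_prime_pow {m : ℕ} (hK : Module.finrank (ZMod q) K = m) (x : K) :
    x ^ q ^ m = x := by
  rw [← card_eq_prime_pow q hK, FiniteField.pow_card]

theorem exists_trace_mul_ne_zero {a : K} (ha : a ≠ 0) :
    ∃ x, Algebra.trace (ZMod q) K (a * x) ≠ 0 := by
  by_contra! h
  exact ha ((traceForm_nondegenerate (ZMod q) K).1 a h)

/-- The additive character `x ↦ ψ (Tr (a x))` of `K`, with `ψ` the standard character. -/
noncomputable def traceChar (q : ℕ) [Fact q.Prime] {K : Type*} [Field K] [Algebra (ZMod q) K]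
    (a : K) : AddChar K ℂ :=
  ZMod.stdAddChar.compAddMonoidHom
    ((Algebra.trace (ZMod q) K).toAddMonoidHom.comp (AddMonoidHom.mulLeft a))

omit [Fintype K] in
theorem traceChar_apply (a x : K) :
    traceChar q a x = ZMod.stdAddChar (Algebra.trace (ZMod q) K (a * x)) := rfl

theorem traceChar_ne_one {a : K} (ha : a ≠ 0) : traceChar q a ≠ 1 := by
  intro h
  have h1 : ∀ x, traceChar q a x = 1 := fun x => by rw [h]; rfl
  obtain ⟨x, hx⟩ := exists_trace_mul_ne_zero (q := q) ha
  refine hx (ZMod.injective_stdAddChar ?_)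
  rw [AddChar.map_zero_eq_one]
  exact h1 x

theorem card_trace_mul_eq {b : K} (hb : b ≠ 0) {m : ℕ} (hK : Module.finrank (ZMod q) K = m)
    (c : ZMod q) [DecidableEq K] :
    (q : ℂ) * (Finset.univ.filter fun x => Algebra.trace (ZMod q) K (b * x) = c).card =
      (q : ℂ) ^ m := by
  classical
  rw [card_mul_card_fiber, Finset.sum_eq_single 0]
  · simp [card_eq_prime_pow q hK]
  · intro t _ ht
    have h := AddChar.sum_eq_zero_of_ne_one
      (traceChar_ne_one (q := q) (mul_ne_zero ((map_ne_zero (algebraMap (ZMod q) K)).mpr ht) hb))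
    simp_rw [traceChar_apply, mul_assoc, ← Algebra.smul_def, map_smul, smul_eq_mul] at h
    rw [h, mul_zero]
  · simp

end FrobeniusPowers

/-! ### Discriminant and exponential sums of the trace form -/

section TraceForm

theorem addChar_map_sum {A ι : Type*} [AddCommMonoid A] (ψ : AddChar A ℂ) (s : Finset ι)
    (f : ι → A) : ψ (∑ i ∈ s, f i) = ∏ i ∈ s, ψ (f i) := by
  classical
  induction s using Finset.induction_on with
  | empty => simp
  | insert i s hi ih => rw [Finset.sum_insert hi, Finset.prod_insert hi, ψ.map_add_eq_mul, ih]

variable {q : ℕ} [Fact q.Prime] {K : Type*} [Field K] [Fintype K] [Algebra (ZMod q) K]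

/-- The discriminant of an extension of finite fields of odd degree is a square. -/
theorem quadraticChar_discr_of_odd (hq : q ≠ 2) {m : ℕ} (hm : Odd m)
    (hK : Module.finrank (ZMod q) K = m) (v : Module.Basis (Fin m) (ZMod q) K) :
    quadraticChar (ZMod q) (Algebra.discr (ZMod q) v) = 1 := by
  have hr : ringChar (ZMod q) ≠ 2 := ringChar_ne_two_of_algebra hq
  -- The matrix of conjugates of the basis: M Mᵀ is the trace matrix, so det M is a square root of
  -- the discriminant in K.
  let M : Matrix (Fin m) (Fin m) K := Matrix.of fun i j => v i ^ q ^ (j : ℕ)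
  have hD : algebraMap (ZMod q) K (Algebra.discr (ZMod q) v) = M.det ^ 2 := by
    have hMM : M.det ^ 2 = (M * M.transpose).det := by
      rw [Matrix.det_mul, Matrix.det_transpose, pow_two]
    rw [Algebra.discr_def, RingHom.map_det, hMM]
    congr 1
    ext i j
    rw [RingHom.mapMatrix_apply, Matrix.map_apply, Algebra.traceMatrix_apply,
      Algebra.traceForm_apply, FiniteField.algebraMap_trace_eq_sum_pow, hK, Matrix.mul_apply,
      ← Fin.sum_univ_eq_sum_range]
    refine Finset.sum_congr rfl fun k _ => ?_
    simp [M, mul_pow, ZMod.card]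
  -- Frobenius rotates the columns of M by an m-cycle, an even permutation for odd m. So det M lies
  -- in GF(q).
  have hfix : M.det ^ q = M.det := by
    have h1 : M.submatrix id (finRotate m) =
        (FiniteField.frobeniusAlgHom (ZMod q) K).toRingHom.mapMatrix M := by
      ext i j
      have h2 : M i j ^ q = v i ^ q ^ ((j : ℕ) + 1) := by
        simp [M, ← pow_mul, pow_succ]
      have h3 : (FiniteField.frobeniusAlgHom (ZMod q) K).toRingHom.mapMatrix M i j = M i j ^ q := by
        simp [FiniteField.coe_frobeniusAlgHom, ZMod.card]
      rw [h3, h2]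
      obtain ⟨n, hn⟩ : ∃ n, m = n + 1 := ⟨m - 1, by have := hm.pos; omega⟩
      subst hn
      change v i ^ q ^ ((finRotate (n + 1) j : Fin (n + 1)) : ℕ) = _
      rw [coe_finRotate]
      split_ifs with hj
      · rw [hj, Fin.val_last, pow_card_prime_pow hK]
        simp
      · rfl
    have h4 := Matrix.det_permute' (finRotate m) M
    rw [h1, sign_finRotate, Even.neg_one_pow (Nat.Odd.sub_odd hm odd_one), Units.val_one,
      Int.cast_one, one_mul, ← RingHom.map_det] at h4
    simpa [FiniteField.coe_frobeniusAlgHom, ZMod.card] using h4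
  have hne : Algebra.discr (ZMod q) v ≠ 0 := Algebra.discr_not_zero_of_basis _ v
  have hdet : M.det ≠ 0 := by
    intro h
    rw [h, zero_pow two_ne_zero] at hD
    exact hne ((map_eq_zero _).mp hD)
  have hq1 : M.det ^ (q - 1) = 1 := by
    have h := (Fact.out : q.Prime).pos
    apply mul_right_cancel₀ hdet
    rw [← pow_succ, Nat.sub_add_cancel h, hfix, one_mul]
  rw [quadraticChar_one_iff_isSquare hne, FiniteField.isSquare_iff hr hne]
  apply (algebraMap (ZMod q) K).injective
  rw [map_pow, hD, ZMod.card, ← pow_mul, map_one, ← hq1]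
  congr 1
  have := (Fact.out : q.Prime).odd_of_ne_two hq
  obtain ⟨k, hk⟩ := this
  omega

/-- The quadratic exponential sums of the trace form in odd degree. -/
theorem sum_stdAddChar_trace_sq (hq : q ≠ 2) {m : ℕ} (hm : Odd m)
    (hK : Module.finrank (ZMod q) K = m) {t : ZMod q} (ht : t ≠ 0) :
    ∑ x : K, ZMod.stdAddChar (t * Algebra.trace (ZMod q) K (x ^ 2)) =
      complexQuadraticChar (ZMod q) t *
        gaussSum (complexQuadraticChar (ZMod q)) ZMod.stdAddChar ^ m := by
  have hr : ringChar (ZMod q) ≠ 2 := ringChar_ne_two_of_algebra hq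
  have : Invertible (2 : ZMod q) := invertibleOfNonzero (Ring.two_ne_zero hr)
  have hψ : (ZMod.stdAddChar : AddChar (ZMod q) ℂ) ≠ 1 := by
    simpa using ZMod.isPrimitive_stdAddChar q one_ne_zero
  -- In an orthogonal basis the form is diagonal, and the sum factors into one-variable quadratic
  -- sums.
  obtain ⟨v, hv⟩ : ∃ v : Module.Basis (Fin m) (ZMod q) K,
      (Algebra.traceForm (ZMod q) K).IsOrthoᵢ v := by
    rw [← hK]
    exact LinearMap.BilinForm.exists_orthogonal_basis ⟨fun x y => by
      rw [Algebra.traceForm_apply, Algebra.traceForm_apply, mul_comm]; rfl⟩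
  have horth : ∀ i j, i ≠ j → Algebra.trace (ZMod q) K (v i * v j) = 0 := fun i j h => hv h
  set d : Fin m → ZMod q := fun i => Algebra.trace (ZMod q) K (v i * v i) with hd
  have hdiscr : Algebra.discr (ZMod q) v = ∏ i, d i := by
    rw [Algebra.discr_def, ← Matrix.det_diagonal]
    congr 1
    ext i j
    rw [Algebra.traceMatrix_apply, Algebra.traceForm_apply, Matrix.diagonal_apply]
    split_ifs with h
    · rw [h]
    · exact horth i j h
  have hd0 : ∀ i, d i ≠ 0 := fun i h =>
    Algebra.discr_not_zero_of_basis (ZMod q) v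
      (hdiscr.trans (Finset.prod_eq_zero (Finset.mem_univ i) h))
  have hsq : ∀ c : Fin m → ZMod q,
      Algebra.trace (ZMod q) K (v.equivFun.symm c ^ 2) = ∑ i, d i * c i ^ 2 := by
    intro c
    rw [Module.Basis.equivFun_symm_apply, pow_two, Finset.sum_mul_sum, map_sum]
    refine Finset.sum_congr rfl fun i _ => ?_
    rw [map_sum, Finset.sum_eq_single i]
    · rw [smul_mul_smul_comm, map_smul, smul_eq_mul, hd]
      ring
    · intro j _ hj
      rw [smul_mul_smul_comm, map_smul, horth i j hj.symm, smul_zero]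
    · simp
  rw [← v.equivFun.symm.toEquiv.sum_comp]
  calc
    _ = ∑ c : Fin m → ZMod q, ∏ i, ZMod.stdAddChar (t * d i * c i ^ 2) := by
      refine Finset.sum_congr rfl fun c _ => ?_
      change ZMod.stdAddChar (t * Algebra.trace (ZMod q) K (v.equivFun.symm c ^ 2)) = _
      rw [hsq, Finset.mul_sum]
      simp_rw [mul_assoc]
      exact addChar_map_sum _ _ _
    _ = ∏ i, ∑ c : ZMod q, ZMod.stdAddChar (t * d i * c ^ 2) := by
      rw [Finset.prod_univ_sum, Fintype.piFinset_univ]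
    _ = ∏ i, complexQuadraticChar (ZMod q) (t * d i) *
          gaussSum (complexQuadraticChar (ZMod q)) ZMod.stdAddChar :=
      Finset.prod_congr rfl fun i _ => sum_addChar_mul_sq hr hψ (mul_ne_zero ht (hd0 i))
    _ = _ := by
      rw [Finset.prod_mul_distrib, Finset.prod_const, ← map_prod, Finset.prod_mul_distrib,
        Finset.prod_const, Finset.card_univ, Fintype.card_fin, ← hdiscr, map_mul, map_pow,
        complexQuadraticChar_apply (Algebra.discr _ _), quadraticChar_discr_of_odd hq hm hK v,
        Int.cast_one, mul_one]
      congr 1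
      -- As m is odd, η(t)^m = η(t).
      obtain ⟨k, rfl⟩ := hm
      rw [pow_succ, pow_mul, complexQuadraticChar_apply, ← Int.cast_pow,
        quadraticChar_sq_one ht, Int.cast_one, one_pow, one_mul]

end TraceForm

/-! ### Exponential sums of the power map with exponent 1 + q^h -/

section PowerSums

open scoped Classical in
/-- Summation along a homomorphism of finite groups. -/
theorem sum_comp_monoidHom {G : Type*} [CommGroup G] [Fintype G] (f : G →* G) (F : G → ℂ) :
    ∑ x, F (f x) = Nat.card f.ker * ∑ y with y ∈ f.range, F y := by
  have himg : Finset.univ.image f = Finset.univ.filter (· ∈ f.range) := by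
    ext y
    simp [MonoidHom.mem_range]
  rw [Finset.sum_comp F f, himg, Finset.mul_sum]
  refine Finset.sum_congr rfl fun y hy => ?_
  rw [nsmul_eq_mul]
  congr 2
  rw [MonoidHom.card_fiber_eq_of_mem_range f (x := y) (y := 1)
    (by simpa using hy) ⟨1, map_one f⟩]
  rw [Nat.card_eq_fintype_card, Fintype.card_subtype]
  simp only [MonoidHom.mem_ker]

/-- Equal kernels force ranges of equal order, so one inclusion makes the ranges equal; all fibres
then have the same size too. -/
theorem sum_comp_eq_of_ker_eq {G : Type*} [CommGroup G] [Fintype G] {f g : G →* G}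
    (hker : f.ker = g.ker) (hrange : f.range ≤ g.range) (F : G → ℂ) :
    ∑ x, F (f x) = ∑ x, F (g x) := by
  have h : f.range = g.range := Subgroup.eq_of_le_of_card_ge hrange (by
    rw [← Subgroup.index_ker, ← Subgroup.index_ker, hker])
  rw [sum_comp_monoidHom, sum_comp_monoidHom, hker]
  congr 1
  refine Finset.sum_congr ?_ fun _ _ => rfl
  ext y
  simp only [Finset.mem_filter, Finset.mem_univ, true_and, h]

theorem sum_eq_add_sum_units {K : Type*} [Field K] [Fintype K] [DecidableEq K] (F : K → ℂ) :
    ∑ x, F x = F 0 + ∑ x : Kˣ, F x := by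
  rw [← Finset.add_sum_erase _ _ (Finset.mem_univ (0 : K))]
  congr 1
  symm
  refine Finset.sum_nbij (fun x : Kˣ => (x : K)) (by simp) (Units.val_injective.injOn) ?_
    (fun _ _ => rfl)
  intro x hx
  have hx0 : x ≠ 0 := by simpa using hx
  exact ⟨Units.mk0 x hx0, by simp, rfl⟩

variable {q : ℕ} [Fact q.Prime] {K : Type*} [Field K] [Fintype K] [DecidableEq K]
  [Algebra (ZMod q) K]

/-- In odd degree `2 k + 1`, the power map `x ↦ x ^ (1 + q ^ (k + 1))` has the same value
distribution as squaring. -/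
theorem sum_pow_one_add_eq_sum_sq (hq : q ≠ 2) {k : ℕ}
    (hK : Module.finrank (ZMod q) K = 2 * k + 1) (F : K → ℂ) :
    ∑ x : K, F (x ^ (1 + q ^ (k + 1))) = ∑ x : K, F (x ^ 2) := by
  have hodd := (Fact.out : q.Prime).odd_of_ne_two hq
  rw [sum_eq_add_sum_units, sum_eq_add_sum_units (fun x => F (x ^ 2))]
  rw [zero_pow two_ne_zero, zero_pow (by omega)]
  congr 1
  -- If x^(q^(k+1)) = x⁻¹, applying this power twice gives x^(q^(2k+2)) = x. Together with
  -- x^(q^(2k+1)) = x this yields x^q = x, hence x^2 = 1.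
  have key : ∀ x : Kˣ, x ^ (1 + q ^ (k + 1)) = 1 ↔ x ^ 2 = 1 := by
    intro x
    have heven : Even (1 + q ^ (k + 1)) := by
      rw [add_comm]; exact (hodd.pow).add_one
    constructor
    · intro h
      have h1 : x ^ q ^ (k + 1) = x⁻¹ := by
        rw [pow_add, pow_one] at h
        exact eq_inv_of_mul_eq_one_right h
      have h2 : x ^ q = x := by
        have h3 : x ^ q ^ (2 * k + 1) = x := by
          ext; rw [Units.val_pow_eq_pow_val]; exact pow_card_prime_pow hK _
        calc x ^ q = (x ^ q ^ (2 * k + 1)) ^ q := by rw [h3]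
          _ = (x ^ q ^ (k + 1)) ^ q ^ (k + 1) := by
            rw [← pow_mul, ← pow_mul, ← pow_succ, ← pow_add]; congr 2; omega
          _ = x := by rw [h1, inv_pow, h1, inv_inv]
      have h4 : ∀ n, x ^ q ^ n = x := by
        intro n
        induction n with
        | zero => simp
        | succ n ih => rw [pow_succ, pow_mul, ih, h2]
      rwa [pow_add, pow_one, h4, ← pow_two] at h
    · intro h
      obtain ⟨n, hn⟩ := heven
      rw [hn, ← two_mul, pow_mul, h, one_pow]
  have := sum_comp_eq_of_ker_eq (f := powMonoidHom (1 + q ^ (k + 1)))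
    (g := (powMonoidHom 2 : Kˣ →* Kˣ)) (by ext x; exact key x) ?_ (fun x => F (x : K))
  · simpa using this
  · rintro _ ⟨x, rfl⟩
    obtain ⟨n, hn⟩ : Even (1 + q ^ (k + 1)) := by
      rw [add_comm]; exact (hodd.pow).add_one
    refine ⟨x ^ n, ?_⟩
    simp only [powMonoidHom_apply]
    rw [hn, ← pow_mul, ← mul_two]

/-- A character of `K` that is nontrivial on the subfield of index two sums to zero there. -/
theorem sum_traceChar_fixed {h : ℕ} (hK : Module.finrank (ZMod q) K = 2 * h) {a : K}
    (ha : a ^ q ^ h + a ≠ 0) :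
    ∑ y : K with y ^ q ^ h = y, traceChar q a y = 0 := by
  obtain ⟨z, hz⟩ := exists_trace_mul_ne_zero (q := q) ha
  -- w is the relative trace of z, so it lies in the subfield, and Tr(aw) = Tr((a^(q^h) + a)z) ≠ 0.
  -- Translation by w multiplies the sum by a constant other than 1.
  set w := z + z ^ q ^ h with hw
  have hzz : (z ^ q ^ h) ^ q ^ h = z := by
    rw [← pow_mul, ← pow_add, ← two_mul, pow_card_prime_pow hK]
  have hwfix : w ^ q ^ h = w := by rw [hw, add_pow_prime_pow, hzz, add_comm]
  have htr : Algebra.trace (ZMod q) K (a * w) = Algebra.trace (ZMod q) K ((a ^ q ^ h + a) * z) := by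
    rw [hw, mul_add, add_mul, map_add, map_add, add_comm, ← trace_pow_prime_pow (a * z ^ q ^ h) h,
      mul_pow, hzz]
  have hne : traceChar q a w ≠ 1 := by
    intro h1
    rw [traceChar_apply, htr] at h1
    exact hz (ZMod.injective_stdAddChar (h1.trans (AddChar.map_zero_eq_one _).symm))
  have hshift : traceChar q a w * ∑ y : K with y ^ q ^ h = y, traceChar q a y =
      ∑ y : K with y ^ q ^ h = y, traceChar q a y := by
    rw [Finset.mul_sum]
    refine Finset.sum_equiv (Equiv.addLeft w) (fun y => ?_) fun y _ => ?_
    · simp [add_pow_prime_pow, hwfix]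
    · exact (AddChar.map_add_eq_mul _ _ _).symm
  by_contra hS
  exact hne (mul_right_cancel₀ hS (hshift.trans (one_mul _).symm))

/-- The exponential sum of a nondegenerate hermitian form in one variable. -/
theorem sum_traceChar_pow_one_add {h : ℕ} (hK : Module.finrank (ZMod q) K = 2 * h) {a : K}
    (ha : a ^ q ^ h + a ≠ 0) :
    ∑ x : K, traceChar q a (x ^ (1 + q ^ h)) = -(q : ℂ) ^ h := by
  have hpos : 1 ≤ q ^ h := Nat.one_le_pow _ _ (Fact.out : q.Prime).pos
  have hcard : Nat.card Kˣ = (1 + q ^ h) * (q ^ h - 1) := by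
    rw [Nat.card_eq_fintype_card, Fintype.card_units, card_eq_prime_pow q hK, mul_comm 2 h, pow_mul,
      add_comm 1, ← Nat.sq_sub_sq, one_pow]
  have hgcd : (Nat.card Kˣ).gcd (1 + q ^ h) = 1 + q ^ h := by
    rw [hcard]; exact Nat.gcd_eq_right (Dvd.intro _ rfl)
  have hcardR : Nat.card (powMonoidHom (1 + q ^ h) : Kˣ →* Kˣ).range = q ^ h - 1 := by
    rw [IsCyclic.card_powMonoidHom_range, hgcd, hcard, Nat.mul_div_cancel_left _ (by omega)]
  -- The norm maps onto the units of the subfield, with fibres of size 1 + q^h. The character sums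
  -- to -1 over those units, whence the total 1 - (1 + q^h).
  have hrange : (powMonoidHom (1 + q ^ h) : Kˣ →* Kˣ).range =
      (powMonoidHom (q ^ h - 1) : Kˣ →* Kˣ).ker := by
    refine Subgroup.eq_of_le_of_card_ge ?_ ?_
    · rintro _ ⟨x, rfl⟩
      rw [MonoidHom.mem_ker, powMonoidHom_apply, powMonoidHom_apply, ← pow_mul, ← hcard,
        pow_card_eq_one']
    · rw [hcardR, IsCyclic.card_powMonoidHom_ker, hcard, Nat.gcd_eq_right (Dvd.intro_left _ rfl)]
  have hmem : ∀ y : Kˣ, y ∈ (powMonoidHom (1 + q ^ h) : Kˣ →* Kˣ).range ↔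
      (y : K) ^ q ^ h = y := by
    intro y
    rw [hrange, MonoidHom.mem_ker, powMonoidHom_apply, ← Units.val_pow_eq_pow_val, Units.val_inj]
    nth_rewrite 2 [← Nat.sub_add_cancel hpos]
    rw [pow_succ, mul_eq_right]
  have h1 := sum_comp_monoidHom (powMonoidHom (1 + q ^ h) : Kˣ →* Kˣ)
    (fun y => traceChar q a (y : K))
  rw [IsCyclic.card_powMonoidHom_ker, hgcd] at h1
  have h2 := sum_traceChar_fixed hK ha
  rw [Finset.sum_filter, sum_eq_add_sum_units, zero_pow (by omega), if_pos rfl,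
    AddChar.map_zero_eq_one] at h2
  rw [Finset.sum_filter] at h1
  simp_rw [hmem] at h1
  rw [sum_eq_add_sum_units, zero_pow (by omega), AddChar.map_zero_eq_one]
  simp only [powMonoidHom_apply, Units.val_pow_eq_pow_val] at h1
  rw [h1, eq_neg_of_add_eq_zero_right h2]
  push_cast
  ring

end PowerSums

/-! ### Counting representations and zeros -/

section Counting

variable {q : ℕ} [Fact q.Prime] {K : Type*} [Field K] [Fintype K] [DecidableEq K]
  [Algebra (ZMod q) K]

/-- The number of representations of `c` by the quadratic form `Tr (a x ^ (1 + q ^ h))`. -/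
noncomputable def formCount (q : ℕ) [Fact q.Prime] {K : Type*} [Field K] [Fintype K]
    [Algebra (ZMod q) K] (h : ℕ) (a : K) (c : ZMod q) : ℕ :=
  (Finset.univ.filter fun x : K => Algebra.trace (ZMod q) K (a * x ^ (1 + q ^ h)) = c).card

/-- The number of zeros of `Tr (a x ^ (1 + q ^ h) + b x)`. -/
noncomputable def zeroCount (q : ℕ) [Fact q.Prime] {K : Type*} [Field K] [Fintype K]
    [Algebra (ZMod q) K] (h : ℕ) (a b : K) : ℕ :=
  (Finset.univ.filter fun x : K =>
    Algebra.trace (ZMod q) K (a * x ^ (1 + q ^ h) + b * x) = 0).card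

omit [DecidableEq K] in
/-- The values of the quadratic form in even degree. -/
theorem formCount_even {k : ℕ} (hK : Module.finrank (ZMod q) K = 2 * (k + 1)) {a : K}
    (ha : a ^ q ^ (k + 1) + a ≠ 0) (c : ZMod q) :
    (formCount q (k + 1) a c : ℤ) =
      q ^ (2 * k + 1) + q ^ k * (if c = 0 then -((q : ℤ) - 1) else 1) := by
  classical
  have hq0 : (q : ℂ) ≠ 0 := Nat.cast_ne_zero.mpr (Fact.out : q.Prime).ne_zero
  have h1 := card_mul_card_fiber
    (fun x : K => Algebra.trace (ZMod q) K (a * x ^ (1 + q ^ (k + 1)))) c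
  -- For t ≠ 0 the coefficient ta is again nondegenerate, because t is fixed by Frobenius; the sum
  -- does not depend on t. The conditional term corrects the value at t = 0.
  have hsum : ∀ t : ZMod q, ∑ x : K,
      ZMod.stdAddChar (t * Algebra.trace (ZMod q) K (a * x ^ (1 + q ^ (k + 1)))) =
        (if t = 0 then (q : ℂ) ^ (2 * (k + 1)) + (q : ℂ) ^ (k + 1) else 0) -
          (q : ℂ) ^ (k + 1) := by
    intro t
    split_ifs with ht
    · simp [ht, card_eq_prime_pow q hK]
    · have hta : (t • a) ^ q ^ (k + 1) + t • a ≠ 0 := by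
        rw [Algebra.smul_def, mul_pow, algebraMap_pow_prime_pow, ← mul_add]
        exact mul_ne_zero ((map_ne_zero _).mpr ht) ha
      have h2 := sum_traceChar_pow_one_add hK hta
      simp_rw [traceChar_apply, smul_mul_assoc, map_smul, smul_eq_mul] at h2
      rw [h2, zero_sub]
  have h3 : ∑ t : ZMod q, ZMod.stdAddChar (-(t * c)) = if c = 0 then (q : ℂ) else 0 := by
    have := AddChar.sum_mulShift (-c) (ZMod.isPrimitive_stdAddChar q)
    simpa [ZMod.card] using this
  simp_rw [hsum, mul_sub, Finset.sum_sub_distrib, ← Finset.sum_mul, h3, mul_ite, mul_zero] at h1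
  rw [Finset.sum_ite_eq' Finset.univ, if_pos (Finset.mem_univ _), zero_mul, neg_zero,
    AddChar.map_zero_eq_one, one_mul] at h1
  have h4 : (q : ℂ) * ((formCount q (k + 1) a c : ℤ) : ℂ) =
      (q : ℂ) * ((q ^ (2 * k + 1) + q ^ k * (if c = 0 then -((q : ℤ) - 1) else 1) : ℤ) : ℂ) := by
    rw [formCount, Int.cast_natCast]
    convert h1 using 1
    push_cast
    split_ifs <;> ring
  exact_mod_cast mul_left_cancel₀ hq0 h4

/-- The values of the quadratic form in odd degree. -/
theorem formCount_odd (hq : q ≠ 2) {k : ℕ} (hK : Module.finrank (ZMod q) K = 2 * k + 1) {a : K}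
    (ha : a ≠ 0) (c : ZMod q) :
    (formCount q (k + 1) a c : ℤ) = q ^ (2 * k) +
      quadraticChar K a * quadraticChar (ZMod q) (-c) * quadraticChar (ZMod q) (-1) ^ (k + 1) *
        q ^ k := by
  have hq0 : (q : ℂ) ≠ 0 := Nat.cast_ne_zero.mpr (Fact.out : q.Prime).ne_zero
  have hr : ringChar (ZMod q) ≠ 2 := ringChar_ne_two_of_algebra hq
  have hrK : ringChar K ≠ 2 := ringChar_ne_two_of_algebra hq
  set χ := complexQuadraticChar (ZMod q) with hχ
  set g := gaussSum χ ZMod.stdAddChar with hg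
  have h1 := card_mul_card_fiber
    (fun x : K => Algebra.trace (ZMod q) K (a * x ^ (1 + q ^ (k + 1)))) c
  have hχ0 : χ 0 = 0 := MulChar.map_zero χ
  have hsum : ∀ t : ZMod q, ∑ x : K,
      ZMod.stdAddChar (t * Algebra.trace (ZMod q) K (a * x ^ (1 + q ^ (k + 1)))) =
        (if t = 0 then (q : ℂ) ^ (2 * k + 1) else 0) +
          complexQuadraticChar K a * χ t * g ^ (2 * k + 1) := by
    intro t
    split_ifs with ht
    · simp [ht, hχ0, card_eq_prime_pow q hK]
    · rw [sum_pow_one_add_eq_sum_sq hq hK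
        (fun y => ZMod.stdAddChar (t * Algebra.trace (ZMod q) K (a * y))), zero_add]
      have hψ : traceChar q (algebraMap (ZMod q) K t) ≠ 1 :=
        traceChar_ne_one ((map_ne_zero (algebraMap (ZMod q) K)).mpr ht)
      -- Comparing coefficient a with coefficient 1 isolates the factor η'(a) without evaluating the
      -- Gauss sum of K.
      have e1 := sum_addChar_mul_sq hrK hψ ha
      have e2 := sum_addChar_mul_sq hrK hψ one_ne_zero
      rw [map_one, one_mul] at e2
      rw [← e2] at e1
      simp_rw [traceChar_apply, ← Algebra.smul_def, map_smul, smul_eq_mul, one_mul] at e1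
      rw [e1, sum_stdAddChar_trace_sq hq ⟨k, rfl⟩ hK ht, mul_assoc]
  have h3 : ∑ t : ZMod q, ZMod.stdAddChar (-(t * c)) * χ t = χ (-c) * g := by
    by_cases hc : c = 0
    · have := MulChar.sum_eq_zero_of_ne_one (complexQuadraticChar_ne_one hr)
      simpa [hc, hχ0] using this
    · have h5 := gaussSum_mulShift_eq χ ZMod.stdAddChar (Units.mk0 (-c) (neg_ne_zero.mpr hc))
      rw [complexQuadraticChar_isQuadratic.inv, Units.val_mk0] at h5
      rw [← h5, gaussSum]
      refine Finset.sum_congr rfl fun t _ => ?_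
      rw [AddChar.mulShift_apply, mul_comm]
      congr 2
      ring
  -- Summing over t supplies one more factor g, so only the even power g^(2k+2) has to be known.
  have hg2 : g ^ 2 = χ (-1) * q := by
    rw [hg, gaussSum_sq (complexQuadraticChar_ne_one hr) complexQuadraticChar_isQuadratic
      (ZMod.isPrimitive_stdAddChar q), ZMod.card]
  have h6 : ∑ t : ZMod q, ZMod.stdAddChar (-(t * c)) *
      (complexQuadraticChar K a * χ t * g ^ (2 * k + 1)) =
        complexQuadraticChar K a * χ (-c) * (χ (-1) * q) ^ (k + 1) := by
    rw [← hg2, ← pow_mul, show 2 * (k + 1) = (2 * k + 1) + 1 by ring, pow_succ]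
    calc _ = complexQuadraticChar K a * g ^ (2 * k + 1) *
          ∑ t : ZMod q, ZMod.stdAddChar (-(t * c)) * χ t := by
          rw [Finset.mul_sum]
          exact Finset.sum_congr rfl fun t _ => by ring
      _ = _ := by rw [h3]; ring
  simp_rw [hsum, mul_add, Finset.sum_add_distrib, h6, mul_ite, mul_zero] at h1
  rw [Finset.sum_ite_eq' Finset.univ, if_pos (Finset.mem_univ _), zero_mul, neg_zero,
    AddChar.map_zero_eq_one, one_mul] at h1
  have h4 : (q : ℂ) * ((formCount q (k + 1) a c : ℤ) : ℂ) =
      (q : ℂ) * ((q ^ (2 * k) + quadraticChar K a * quadraticChar (ZMod q) (-c) *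
        quadraticChar (ZMod q) (-1) ^ (k + 1) * q ^ k : ℤ) : ℂ) := by
    rw [formCount, Int.cast_natCast]
    convert h1 using 1
    push_cast
    rw [hχ, complexQuadraticChar_apply, complexQuadraticChar_apply, complexQuadraticChar_apply]
    ring
  exact_mod_cast mul_left_cancel₀ hq0 h4

omit [DecidableEq K] in
/-- Completing the square. -/
theorem trace_form_add_linear {h : ℕ} {a b x₀ : K}
    (hx : a ^ q ^ h * x₀ ^ q ^ (2 * h) + a * x₀ + b ^ q ^ h = 0) (y : K) :
    Algebra.trace (ZMod q) K (a * y ^ (1 + q ^ h) + b * y) =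
      Algebra.trace (ZMod q) K (a * (y - x₀) ^ (1 + q ^ h)) -
        Algebra.trace (ZMod q) K (a * x₀ ^ (1 + q ^ h)) := by
  -- The equation for x₀ says exactly that Tr(by) matches the cross terms of a(y - x₀)^(1+q^h), once
  -- the trace is seen to be Frobenius invariant.
  have h1 : Algebra.trace (ZMod q) K (b * y) = - Algebra.trace (ZMod q) K (a * x₀ ^ q ^ h * y) -
      Algebra.trace (ZMod q) K (a * x₀ * y ^ q ^ h) := by
    have h2 : b ^ q ^ h = -(a ^ q ^ h * x₀ ^ q ^ (2 * h)) - a * x₀ := by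
      linear_combination hx
    rw [← trace_pow_prime_pow (b * y) h, ← trace_pow_prime_pow (a * x₀ ^ q ^ h * y) h,
      ← map_neg, ← map_sub]
    congr 1
    rw [mul_pow, h2, mul_pow, mul_pow, ← pow_mul, ← pow_add, ← two_mul]
    ring
  rw [map_add, h1, ← map_neg, ← map_sub, ← map_add, ← map_sub]
  congr 1
  simp only [pow_add, pow_one, sub_pow_prime_pow]
  ring

omit [DecidableEq K] in
theorem zeroCount_eq_formCount {h : ℕ} {a b x₀ : K}
    (hx : a ^ q ^ h * x₀ ^ q ^ (2 * h) + a * x₀ + b ^ q ^ h = 0) :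
    zeroCount q h a b =
      formCount q h a (Algebra.trace (ZMod q) K (a * x₀ ^ (1 + q ^ h))) := by
  refine Finset.card_equiv (Equiv.subRight x₀) fun y => ?_
  rw [Finset.mem_filter_univ, Finset.mem_filter_univ, trace_form_add_linear hx, sub_eq_zero]
  rfl

/-- The weight of a codeword and the number of zeros of its polynomial add up to `q ^ m`. -/
theorem hammingNorm_codeword_add {m : ℕ} (hK : Module.finrank (ZMod q) K = m) (a b : K) :
    hammingNorm (codeword q m K a b) + zeroCount q ((m - 1) / 2 + 1) a b = q ^ m := by
  rw [zeroCount]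
  set f : K → ZMod q := fun y =>
    Algebra.trace (ZMod q) K (a * y ^ (1 + q ^ ((m - 1) / 2 + 1)) + b * y) with hf
  have h1 : hammingNorm (codeword q m K a b) = (Finset.univ.filter fun y : K => f y ≠ 0).card := by
    refine Finset.card_bij (fun x _ => (x : K)) ?_ (fun _ _ _ _ h => Units.ext h) ?_
    · intro x hx
      simpa [hf, codeword] using hx
    · intro y hy
      have hy' : f y ≠ 0 := by simpa using hy
      -- Restricting to nonzero x loses no weight: the polynomial vanishes at 0.
      have hy0 : y ≠ 0 := by
        rintro rfl
        simp [hf] at hy'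
      exact ⟨Units.mk0 y hy0, by simpa [hf, codeword] using hy', rfl⟩
  rw [h1, add_comm, Finset.card_filter_add_card_filter_not, Finset.card_univ,
    card_eq_prime_pow q hK]

end Counting

/-! ### From numbers of zeros to weights; degenerate forms -/

section Weights

variable {q : ℕ} [Fact q.Prime] {K : Type*} [Field K] [Fintype K] [DecidableEq K]
  [Algebra (ZMod q) K]

-- Neither subtraction in `delta2` truncates for these q and m. The bracket is the number of zeros
-- belonging to the weight δ₂ + 1.
omit [Fact q.Prime] in
theorem delta2_succ_add (hq : 3 ≤ q) {m : ℕ} (hm : 2 ≤ m) :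
    delta2 q m + 1 + (q ^ (m - 1) + q ^ ((m - 1) / 2)) = q ^ m := by
  have h1 : q ^ ((m - 1) / 2) ≤ q ^ (m - 1) := Nat.pow_le_pow_right (by omega) (by omega)
  have h2 : 1 ≤ q ^ (m - 1) := Nat.one_le_pow _ _ (by omega)
  have h3 : q ^ m = (q - 1) * q ^ (m - 1) + q ^ (m - 1) := by
    rw [← Nat.succ_mul, Nat.succ_eq_add_one, Nat.sub_add_cancel (by omega), ← pow_succ',
      Nat.sub_add_cancel (by omega)]
  have h4 : 2 * q ^ (m - 1) ≤ (q - 1) * q ^ (m - 1) := Nat.mul_le_mul_right _ (by omega)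
  unfold delta2
  omega

theorem three_le_of_prime_ne_two (hq : q ≠ 2) : 3 ≤ q := by
  have := (Fact.out : q.Prime).two_le
  omega

theorem hammingNorm_codeword_eq_iff (hq : q ≠ 2) {m : ℕ} (hm : 2 ≤ m)
    (hK : Module.finrank (ZMod q) K = m) (a b : K) :
    hammingNorm (codeword q m K a b) = delta2 q m + 1 ↔
      zeroCount q ((m - 1) / 2 + 1) a b = q ^ (m - 1) + q ^ ((m - 1) / 2) := by
  have h1 := hammingNorm_codeword_add hK a b
  have h2 := delta2_succ_add (three_le_of_prime_ne_two hq) hm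
  omega

/-- The minimum weight is determined by the maximal number of zeros. -/
theorem isLeast_weight_of_zeroCount (hq : q ≠ 2) {m : ℕ} (hm : 2 ≤ m)
    (hK : Module.finrank (ZMod q) K = m)
    (hle : ∀ a b : K, codeword q m K a b ≠ 0 →
      zeroCount q ((m - 1) / 2 + 1) a b ≤ q ^ (m - 1) + q ^ ((m - 1) / 2))
    (hex : ∃ a b : K,
      zeroCount q ((m - 1) / 2 + 1) a b = q ^ (m - 1) + q ^ ((m - 1) / 2)) :
    IsLeast {w : ℕ | ∃ c ∈ codeDelta2 q m K, c ≠ 0 ∧ hammingNorm c = w} (delta2 q m + 1) := by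
  constructor
  · obtain ⟨a, b, hab⟩ := hex
    have hw := (hammingNorm_codeword_eq_iff hq hm hK a b).mpr hab
    refine ⟨_, ⟨a, b, rfl⟩, ?_, hw⟩
    intro h
    rw [h, hammingNorm_zero] at hw
    omega
  · rintro w ⟨c, ⟨a, b, rfl⟩, hc, rfl⟩
    have h1 := hammingNorm_codeword_add hK a b
    have h2 := delta2_succ_add (three_le_of_prime_ne_two hq) hm
    have h3 := hle a b hc
    omega

omit [DecidableEq K] in
theorem zeroCount_of_form_eq_zero {m h : ℕ} (hm : 1 ≤ m) (hK : Module.finrank (ZMod q) K = m)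
    {a b : K} (ha : ∀ x : K, Algebra.trace (ZMod q) K (a * x ^ (1 + q ^ h)) = 0) (hb : b ≠ 0) :
    zeroCount q h a b = q ^ (m - 1) := by
  classical
  have h1 := card_trace_mul_eq hb hK 0
  have h2 : q * zeroCount q h a b = q * q ^ (m - 1) := by
    rw [← pow_succ', Nat.sub_add_cancel hm]
    rw [zeroCount]
    simp_rw [map_add, ha, zero_add]
    exact_mod_cast h1
  exact Nat.eq_of_mul_eq_mul_left (Fact.out : q.Prime).pos h2

omit [DecidableEq K] in
theorem zeroCount_zero_right_of_form_eq_zero {m h : ℕ} (hK : Module.finrank (ZMod q) K = m)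
    {a : K} (ha : ∀ x : K, Algebra.trace (ZMod q) K (a * x ^ (1 + q ^ h)) = 0) :
    zeroCount q h a 0 = q ^ m := by
  simp [zeroCount, ha, card_eq_prime_pow q hK]

/-- A degenerate quadratic form never leads to a codeword of minimum weight. -/
theorem zeroCount_ne_of_form_eq_zero (hq : q ≠ 2) {m h : ℕ} (hm : 2 ≤ m)
    (hK : Module.finrank (ZMod q) K = m) {a b : K}
    (ha : ∀ x : K, Algebra.trace (ZMod q) K (a * x ^ (1 + q ^ h)) = 0) :
    zeroCount q h a b ≠ q ^ (m - 1) + q ^ ((m - 1) / 2) := by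
  have hpos : 0 < q ^ ((m - 1) / 2) := pow_pos (Fact.out : q.Prime).pos _
  by_cases hb : b = 0
  · have h2 := delta2_succ_add (three_le_of_prime_ne_two hq) hm
    rw [hb, zeroCount_zero_right_of_form_eq_zero hK ha]
    omega
  · rw [zeroCount_of_form_eq_zero (by omega) hK ha hb]
    omega

omit [DecidableEq K] in
theorem zeroCount_le_of_form_eq_zero {m : ℕ} (hm : 1 ≤ m)
    (hK : Module.finrank (ZMod q) K = m) {a b : K}
    (ha : ∀ x : K, Algebra.trace (ZMod q) K (a * x ^ (1 + q ^ ((m - 1) / 2 + 1))) = 0)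
    (hc : codeword q m K a b ≠ 0) :
    zeroCount q ((m - 1) / 2 + 1) a b ≤ q ^ (m - 1) + q ^ ((m - 1) / 2) := by
  have hb : b ≠ 0 := by
    rintro rfl
    refine hc (funext fun x => ?_)
    simp [codeword, ha]
  rw [zeroCount_of_form_eq_zero hm hK ha hb]
  exact Nat.le_add_right _ _

end Weights

/-! ### Even degree -/

section EvenDegree

variable {q : ℕ} [Fact q.Prime] {K : Type*} [Field K] [Fintype K] [Algebra (ZMod q) K]

/-- The power q^h fixes x^(1+q^h) and negates a, so the trace equals its own negative. -/
theorem form_eq_zero_of_even (hq : q ≠ 2) {h : ℕ} (hK : Module.finrank (ZMod q) K = 2 * h) {a : K}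
    (ha : a ^ q ^ h + a = 0) (x : K) : Algebra.trace (ZMod q) K (a * x ^ (1 + q ^ h)) = 0 := by
  have h1 := trace_pow_prime_pow (q := q) (a * x ^ (1 + q ^ h)) h
  have h2 : (a * x ^ (1 + q ^ h)) ^ q ^ h = -(a * x ^ (1 + q ^ h)) := by
    rw [mul_pow, eq_neg_of_add_eq_zero_left ha, ← pow_mul, add_mul, one_mul, ← pow_add, ← two_mul,
      pow_add, pow_card_prime_pow hK]
    ring
  rw [h2, map_neg] at h1
  have hr : ringChar (ZMod q) ≠ 2 := ringChar_ne_two_of_algebra hq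
  exact (Ring.eq_self_iff_eq_zero_of_char_ne_two hr).mp h1

/-- Since x₀^(q^(2h)) = x₀, the equation for x₀ is linear: x₀ = -b^(q^h)/A with A = a^(q^h) + a, and
A is fixed by the power q^h. -/
theorem zeroCount_even {k : ℕ} (hK : Module.finrank (ZMod q) K = 2 * (k + 1)) {a : K}
    (ha : a ^ q ^ (k + 1) + a ≠ 0) (b : K) :
    (zeroCount q (k + 1) a b : ℤ) = q ^ (2 * k + 1) + q ^ k *
      (if Algebra.trace (ZMod q) K (a * b ^ (1 + q ^ (k + 1)) / (a ^ q ^ (k + 1) + a) ^ 2) = 0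
        then -((q : ℤ) - 1) else 1) := by
  set A := a ^ q ^ (k + 1) + a with hA
  have hpow : ∀ x : K, x ^ q ^ (2 * (k + 1)) = x := pow_card_prime_pow hK
  have hAA : A ^ q ^ (k + 1) = A := by
    rw [hA, add_pow_prime_pow, ← pow_mul, ← pow_add, ← two_mul, hpow, add_comm]
  have hx : a ^ q ^ (k + 1) * (-(b ^ q ^ (k + 1) / A)) ^ q ^ (2 * (k + 1)) +
      a * (-(b ^ q ^ (k + 1) / A)) + b ^ q ^ (k + 1) = 0 := by
    rw [hpow, ← add_mul, ← hA, mul_neg, mul_div_cancel₀ _ ha]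
    exact neg_add_cancel _
  have hval : a * (-(b ^ q ^ (k + 1) / A)) ^ (1 + q ^ (k + 1)) =
      a * b ^ (1 + q ^ (k + 1)) / A ^ 2 := by
    have h0 := sub_pow_prime_pow (q := q) 0 (b ^ q ^ (k + 1) / A) (k + 1)
    rw [zero_sub, zero_pow (pow_ne_zero _ (Fact.out : q.Prime).ne_zero), zero_sub, div_pow, hAA,
      ← pow_mul, ← pow_add, ← two_mul, hpow] at h0
    rw [pow_add, pow_one, h0, pow_add b, pow_one]
    generalize b ^ q ^ (k + 1) = B
    field_simp
  rw [zeroCount_eq_formCount hx, formCount_even hK ha, hval]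

theorem zeroCount_even_eq_iff (hq : q ≠ 2) {k : ℕ} (hK : Module.finrank (ZMod q) K = 2 * (k + 1))
    (a b : K) :
    zeroCount q (k + 1) a b = q ^ (2 * k + 1) + q ^ k ↔
      a ^ q ^ (k + 1) + a ≠ 0 ∧ b ≠ 0 ∧
        Algebra.trace (ZMod q) K
          (a * b ^ (1 + q ^ (k + 1)) / (a ^ q ^ (k + 1) + a) ^ 2) ≠ 0 := by
  classical
  by_cases ha : a ^ q ^ (k + 1) + a = 0
  · have := zeroCount_ne_of_form_eq_zero (b := b) hq (by omega) hK (form_eq_zero_of_even hq hK ha)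
    rw [show 2 * (k + 1) - 1 = 2 * k + 1 by omega, show (2 * k + 1) / 2 = k by omega] at this
    simp [ha, this]
  · have h1 := zeroCount_even hK ha b
    have hq3 := three_le_of_prime_ne_two hq
    have hpos : (0 : ℤ) < (q : ℤ) ^ k := by positivity
    rw [← Nat.cast_inj (R := ℤ), h1]
    split_ifs with ht
    · push_cast
      refine iff_of_false (fun h => ?_) (fun h => h.2.2 ht)
      have h2 : (q : ℤ) ^ k * q = 0 := by linear_combination -h
      have : (q : ℤ) ^ k * q ≠ 0 := by positivity
      exact this h2
    · push_cast
      refine iff_of_true (by ring) ⟨ha, ?_, ht⟩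
      rintro rfl
      exact ht (by simp)

theorem zeroCount_even_le {k : ℕ} (hK : Module.finrank (ZMod q) K = 2 * (k + 1)) {a : K}
    (ha : a ^ q ^ (k + 1) + a ≠ 0) (b : K) :
    zeroCount q (k + 1) a b ≤ q ^ (2 * k + 1) + q ^ k := by
  have h1 := zeroCount_even hK ha b
  have hpos : (0 : ℤ) ≤ (q : ℤ) ^ k := by positivity
  zify
  rw [h1]
  split_ifs
  · nlinarith [mul_nonneg hpos (Nat.cast_nonneg (α := ℤ) q)]
  · linarith

theorem exists_zeroCount_even_eq (hq : q ≠ 2) {k : ℕ}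
    (hK : Module.finrank (ZMod q) K = 2 * (k + 1)) :
    ∃ a b : K, zeroCount q (k + 1) a b = q ^ (2 * k + 1) + q ^ k := by
  have hr : ringChar K ≠ 2 := ringChar_ne_two_of_algebra hq
  have hA : (1 : K) ^ q ^ (k + 1) + 1 ≠ 0 := by
    rw [one_pow, one_add_one_eq_two]; exact Ring.two_ne_zero hr
  have hq0 : 0 < q := (Fact.out : q.Prime).pos
  have h1 := formCount_even hK hA 1
  rw [if_neg one_ne_zero, mul_one] at h1
  have h2 : formCount q (k + 1) (1 : K) 1 = q ^ (2 * k + 1) + q ^ k := by exact_mod_cast h1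
  have h3 : 0 < formCount q (k + 1) (1 : K) 1 := by rw [h2]; positivity
  obtain ⟨x, hx⟩ := Finset.card_pos.mp h3
  rw [Finset.mem_filter_univ] at hx
  -- Completing the square is run backwards: x has Q(x) = 1, and b is chosen so that x solves the
  -- equation for x₀.
  obtain ⟨b, hb⟩ := pow_prime_pow_surjective (q := q) (k + 1)
    (-((1 : K) ^ q ^ (k + 1) * x ^ q ^ (2 * (k + 1)) + 1 * x))
  refine ⟨1, b, ?_⟩
  rw [zeroCount_eq_formCount (x₀ := x), hx, h2]
  exact (congrArg _ hb).trans (add_neg_cancel _)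

end EvenDegree

/-! ### Odd degree -/

section OddDegree

variable {q : ℕ} [Fact q.Prime] {K : Type*} [Field K] [Fintype K] [Algebra (ZMod q) K]

/-- Norms decide: a^(q^h) x^q has norm N(ax), whereas -ax has norm -N(ax) in odd degree. -/
theorem eq_zero_of_linearized_eq_zero (hq : q ≠ 2) {m h : ℕ} (hm : Odd m)
    (hK : Module.finrank (ZMod q) K = m) {a x : K} (ha : a ≠ 0)
    (hx : a ^ q ^ h * x ^ q + a * x = 0) : x = 0 := by
  by_contra hx0
  have h1 : a ^ q ^ h * x ^ q = algebraMap (ZMod q) K (-1) * (a * x) := by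
    rw [map_neg, map_one]
    linear_combination hx
  have h2 := congrArg (Algebra.norm (ZMod q)) h1
  rw [map_mul, map_mul, Algebra.norm_algebraMap, hK, hm.neg_one_pow, map_pow, map_pow, map_mul,
    ZMod.pow_card_pow, ZMod.pow_card] at h2
  have h3 : Algebra.norm (ZMod q) a * Algebra.norm (ZMod q) x ≠ 0 :=
    mul_ne_zero (Algebra.norm_ne_zero_iff.mpr ha) (Algebra.norm_ne_zero_iff.mpr hx0)
  rw [neg_one_mul] at h2
  have hr : ringChar (ZMod q) ≠ 2 := ringChar_ne_two_of_algebra hq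
  exact h3 ((Ring.eq_self_iff_eq_zero_of_char_ne_two hr).mp h2.symm)

/-- The affine equation attached to a nondegenerate form has exactly one solution. -/
theorem existsUnique_linearized_eq (hq : q ≠ 2) {m h : ℕ} (hm : Odd m)
    (hK : Module.finrank (ZMod q) K = m) {a : K} (ha : a ≠ 0) (c : K) :
    ∃! x : K, a ^ q ^ h * x ^ q + a * x + c = 0 := by
  have hinj : Function.Injective fun x : K => a ^ q ^ h * x ^ q + a * x := by
    intro x y hxy
    have h1 := sub_pow_prime_pow (q := q) x y 1
    rw [pow_one] at h1
    refine sub_eq_zero.mp (eq_zero_of_linearized_eq_zero (h := h) hq hm hK ha ?_)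
    rw [h1]
    simp only at hxy
    linear_combination hxy
  obtain ⟨x, hx⟩ := Finite.surjective_of_injective hinj (-c)
  refine ⟨x, eq_neg_iff_add_eq_zero.mp hx, fun y hy => hinj ?_⟩
  exact (eq_neg_of_add_eq_zero_left hy).trans hx.symm

variable [DecidableEq K]

/-- For odd m, q^m and q agree modulo 4. -/
theorem quadraticChar_neg_one_of_odd {k : ℕ} (hq : q ≠ 2)
    (hK : Module.finrank (ZMod q) K = 2 * k + 1) :
    quadraticChar K (-1) = quadraticChar (ZMod q) (-1) := by
  have hr : ringChar (ZMod q) ≠ 2 := ringChar_ne_two_of_algebra hq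
  have hrK : ringChar K ≠ 2 := ringChar_ne_two_of_algebra hq
  have hodd := (Fact.out : q.Prime).odd_of_ne_two hq
  rw [quadraticChar_neg_one hrK, quadraticChar_neg_one hr, card_eq_prime_pow q hK, ZMod.card,
    Nat.cast_pow, map_pow, pow_succ, pow_mul]
  have h1 : ZMod.χ₄ q ^ 2 = 1 := by
    rcases Nat.odd_mod_four_iff.mp (Nat.odd_iff.mp hodd) with h | h
    · rw [ZMod.χ₄_nat_one_mod_four h]; rfl
    · rw [ZMod.χ₄_nat_three_mod_four h]; rfl
  rw [h1, one_pow, one_mul]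

/-- Here x₀^(q^(2k+2)) = x₀^q. The sign in η(-c) moves over to η'(-a) because η'(-1) = η(-1). -/
theorem zeroCount_odd (hq : q ≠ 2) {k : ℕ} (hK : Module.finrank (ZMod q) K = 2 * k + 1)
    {a b x₀ : K} (ha : a ≠ 0) (hx : a ^ q ^ (k + 1) * x₀ ^ q + a * x₀ + b ^ q ^ (k + 1) = 0) :
    (zeroCount q (k + 1) a b : ℤ) = q ^ (2 * k) + quadraticChar K (-a) *
      quadraticChar (ZMod q) (Algebra.trace (ZMod q) K (a * x₀ ^ (1 + q ^ (k + 1)))) *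
        quadraticChar (ZMod q) (-1) ^ (k + 1) * q ^ k := by
  have hx' : x₀ ^ q ^ (2 * (k + 1)) = x₀ ^ q := by
    rw [show 2 * (k + 1) = 2 * k + 1 + 1 by ring, pow_succ, pow_mul, pow_card_prime_pow hK]
  rw [zeroCount_eq_formCount (by rwa [hx']), formCount_odd hq hK ha, neg_eq_neg_one_mul a,
    map_mul (quadraticChar K), quadraticChar_neg_one_of_odd hq hK,
    neg_eq_neg_one_mul (Algebra.trace _ _ _), map_mul (quadraticChar (ZMod q))]
  ring

/-- In odd degree, a nondegenerate form attains the maximal number of zeros exactly when a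
certain sign is positive. -/
theorem zeroCount_odd_eq_iff (hq : q ≠ 2) {k : ℕ} (hk : k ≠ 0)
    (hK : Module.finrank (ZMod q) K = 2 * k + 1) (a b : K) :
    zeroCount q (k + 1) a b = q ^ (2 * k) + q ^ k ↔
      a * b ≠ 0 ∧ ∃ x₀ : K, a ^ q ^ (k + 1) * x₀ ^ q + a * x₀ + b ^ q ^ (k + 1) = 0 ∧
        quadraticChar K (-a) *
          quadraticChar (ZMod q) (Algebra.trace (ZMod q) K (a * x₀ ^ (1 + q ^ (k + 1)))) *
            quadraticChar (ZMod q) (-1) ^ (k + 1) = 1 := by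
  have hq0 : 0 < q := (Fact.out : q.Prime).pos
  by_cases ha : a = 0
  · have := zeroCount_ne_of_form_eq_zero (q := q) (h := k + 1) (a := a) (b := b) hq (by omega) hK
      (by simp [ha])
    rw [Nat.add_sub_cancel, Nat.mul_div_cancel_left _ two_pos] at this
    refine iff_of_false this fun h => h.1 ?_
    rw [ha, zero_mul]
  · have hpos : (q : ℤ) ^ k ≠ 0 := by positivity
    have key : ∀ x₀ : K, a ^ q ^ (k + 1) * x₀ ^ q + a * x₀ + b ^ q ^ (k + 1) = 0 →
        (zeroCount q (k + 1) a b = q ^ (2 * k) + q ^ k ↔ quadraticChar K (-a) *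
          quadraticChar (ZMod q) (Algebra.trace (ZMod q) K (a * x₀ ^ (1 + q ^ (k + 1)))) *
            quadraticChar (ZMod q) (-1) ^ (k + 1) = 1) := by
      intro x₀ hx
      rw [← Nat.cast_inj (R := ℤ), zeroCount_odd hq hK ha hx]
      push_cast
      rw [add_right_inj, mul_eq_right₀ hpos]
    constructor
    · intro h
      obtain ⟨x₀, hx, huniq⟩ := existsUnique_linearized_eq (h := k + 1) hq ⟨k, rfl⟩ hK ha
        (b ^ q ^ (k + 1))
      have h1 := (key x₀ hx).mp h
      refine ⟨mul_ne_zero ha ?_, x₀, hx, h1⟩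
      -- If b = 0, the unique solution is x₀ = 0, where η vanishes and the product cannot be 1.
      rintro rfl
      have hx0 : x₀ = 0 := by
        refine (huniq 0 ?_).symm
        simp [hq0.ne']
      simp [hx0] at h1
    · rintro ⟨-, x₀, hx, h1⟩
      exact (key x₀ hx).mpr h1

theorem abs_quadraticChar_le_one {F : Type*} [Field F] [Fintype F] [DecidableEq F] (y : F) :
    |quadraticChar F y| ≤ 1 := by
  rcases quadraticChar_isQuadratic F y with h | h | h <;> simp [h]

theorem zeroCount_odd_le (hq : q ≠ 2) {k : ℕ} (hK : Module.finrank (ZMod q) K = 2 * k + 1) {a : K}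
    (ha : a ≠ 0) (b : K) :
    zeroCount q (k + 1) a b ≤ q ^ (2 * k) + q ^ k := by
  obtain ⟨x₀, hx, -⟩ := existsUnique_linearized_eq (h := k + 1) hq ⟨k, rfl⟩ hK ha
    (b ^ q ^ (k + 1))
  have h1 := zeroCount_odd hq hK ha hx
  have hpos : (0 : ℤ) ≤ (q : ℤ) ^ k := by positivity
  have h2 : quadraticChar K (-a) *
      quadraticChar (ZMod q) (Algebra.trace (ZMod q) K (a * x₀ ^ (1 + q ^ (k + 1)))) *
        quadraticChar (ZMod q) (-1) ^ (k + 1) ≤ 1 := by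
    refine (le_abs_self _).trans ?_
    rw [abs_mul, abs_mul, abs_pow]
    exact mul_le_one₀ (mul_le_one₀ (abs_quadraticChar_le_one _) (abs_nonneg _)
      (abs_quadraticChar_le_one _)) (by positivity)
      (pow_le_one₀ (abs_nonneg _) (abs_quadraticChar_le_one _))
  zify
  rw [h1]
  have := mul_le_mul_of_nonneg_right h2 hpos
  linarith

theorem exists_zeroCount_odd_eq (hq : q ≠ 2) {k : ℕ}
    (hK : Module.finrank (ZMod q) K = 2 * k + 1) :
    ∃ a b : K, zeroCount q (k + 1) a b = q ^ (2 * k) + q ^ k := by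
  have hq0 : 0 < q := (Fact.out : q.Prime).pos
  -- The value c = (-1)^k makes η(-c) η(-1)^(k+1) = η(-1)^(2(k+1)) = 1.
  have h1 := formCount_odd hq hK (one_ne_zero (α := K)) ((-1) ^ k)
  have hne : (-1 : ZMod q) ≠ 0 := neg_ne_zero.mpr one_ne_zero
  rw [map_one, one_mul, neg_eq_neg_one_mul (_ ^ k), ← pow_succ', map_pow, ← pow_add, ← two_mul,
    pow_mul (quadraticChar _ _), quadraticChar_sq_one hne, one_pow, one_mul] at h1
  have h2 : formCount q (k + 1) (1 : K) ((-1) ^ k) = q ^ (2 * k) + q ^ k := by exact_mod_cast h1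
  have h3 : 0 < formCount q (k + 1) (1 : K) ((-1) ^ k) := by rw [h2]; positivity
  obtain ⟨x, hx⟩ := Finset.card_pos.mp h3
  rw [Finset.mem_filter_univ] at hx
  obtain ⟨b, hb⟩ := pow_prime_pow_surjective (q := q) (k + 1)
    (-((1 : K) ^ q ^ (k + 1) * x ^ q ^ (2 * (k + 1)) + 1 * x))
  refine ⟨1, b, ?_⟩
  rw [zeroCount_eq_formCount (x₀ := x), hx, h2]
  exact (congrArg _ hb).trans (add_neg_cancel _)

end OddDegree

/-! ### The main theorem -/

theorem mainTheorem7 (q m : ℕ) [Fact q.Prime] (hq : q ≠ 2) (hm : 4 ≤ m)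
    (K : Type*) [Field K] [Fintype K] [DecidableEq K] [Algebra (ZMod q) K]
    (hK : Module.finrank (ZMod q) K = m) :
    -- the minimum weight of the code is `δ₂ + 1`
    IsLeast {w : ℕ | ∃ c ∈ codeDelta2 q m K, c ≠ 0 ∧ hammingNorm c = w} (delta2 q m + 1) ∧
    -- `m` odd
    (Odd m →
      (∀ a b : K, a ≠ 0 →
        ∃! x : K, a ^ q ^ ((m + 1) / 2) * x ^ q + a * x + b ^ q ^ ((m + 1) / 2) = 0) ∧
      (q % 4 = 1 → ∀ a b : K,
        (hammingNorm (codeword q m K a b) = delta2 q m + 1 ↔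
          a * b ≠ 0 ∧
          ∃ x₀ : K, a ^ q ^ ((m + 1) / 2) * x₀ ^ q + a * x₀ + b ^ q ^ ((m + 1) / 2) = 0 ∧
            quadraticChar K (-a) *
              quadraticChar (ZMod q)
                (Algebra.trace (ZMod q) K (a * x₀ ^ (1 + q ^ ((m + 1) / 2)))) = 1)) ∧
      (q % 4 = 3 → ∀ a b : K,
        (hammingNorm (codeword q m K a b) = delta2 q m + 1 ↔
          a * b ≠ 0 ∧
          ∃ x₀ : K, a ^ q ^ ((m + 1) / 2) * x₀ ^ q + a * x₀ + b ^ q ^ ((m + 1) / 2) = 0 ∧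
            Complex.I ^ (3 * m + 3) * (quadraticChar K (-a) : ℂ) *
              (quadraticChar (ZMod q)
                (Algebra.trace (ZMod q) K (a * x₀ ^ (1 + q ^ ((m + 1) / 2)))) : ℂ) = 1))) ∧
    -- `m` even
    (Even m → ∀ a b : K,
      (hammingNorm (codeword q m K a b) = delta2 q m + 1 ↔
        a ^ q ^ (m / 2) + a ≠ 0 ∧ b ≠ 0 ∧
          Algebra.trace (ZMod q) K
            (a * b ^ (1 + q ^ (m / 2)) / (a ^ q ^ (m / 2) + a) ^ 2) ≠ 0)) := by
  have hKpos : 2 ≤ m := by omega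
  refine ⟨?_, ?_, ?_⟩
  · rcases Nat.even_or_odd' m with ⟨j, rfl | rfl⟩
    · obtain ⟨k, rfl⟩ : ∃ k, j = k + 1 := ⟨j - 1, by omega⟩
      refine isLeast_weight_of_zeroCount hq hKpos hK (fun a b hc => ?_) ?_
      · by_cases ha : a ^ q ^ (k + 1) + a = 0
        · refine zeroCount_le_of_form_eq_zero (by omega) hK (fun x => ?_) hc
          rw [show (2 * (k + 1) - 1) / 2 = k by omega]
          exact form_eq_zero_of_even hq hK ha x
        · rw [show (2 * (k + 1) - 1) / 2 = k by omega, show 2 * (k + 1) - 1 = 2 * k + 1 by omega]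
          exact zeroCount_even_le hK ha b
      · rw [show (2 * (k + 1) - 1) / 2 = k by omega, show 2 * (k + 1) - 1 = 2 * k + 1 by omega]
        exact exists_zeroCount_even_eq hq hK
    · refine isLeast_weight_of_zeroCount hq hKpos hK (fun a b hc => ?_) ?_
      · by_cases ha : a = 0
        · exact zeroCount_le_of_form_eq_zero (by omega) hK (by simp [ha]) hc
        · rw [Nat.add_sub_cancel, Nat.mul_div_cancel_left _ two_pos]
          exact zeroCount_odd_le hq hK ha b
      · rw [Nat.add_sub_cancel, Nat.mul_div_cancel_left _ two_pos]
        exact exists_zeroCount_odd_eq hq hK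
  · rintro ⟨k, rfl⟩
    have hr : ringChar (ZMod q) ≠ 2 := ringChar_ne_two_of_algebra hq
    have hiff : ∀ a b : K, hammingNorm (codeword q (2 * k + 1) K a b) = delta2 q (2 * k + 1) + 1 ↔
        zeroCount q (k + 1) a b = q ^ (2 * k) + q ^ k := fun a b => by
      rw [hammingNorm_codeword_eq_iff hq hKpos hK, Nat.add_sub_cancel,
        Nat.mul_div_cancel_left _ two_pos]
    rw [show (2 * k + 1 + 1) / 2 = k + 1 by omega]
    refine ⟨fun a b ha => existsUnique_linearized_eq hq ⟨k, rfl⟩ hK ha _, fun h1 a b => ?_,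
      fun h3 a b => ?_⟩
    · rw [hiff, zeroCount_odd_eq_iff hq (by omega) hK, quadraticChar_neg_one hr, ZMod.card,
        ZMod.χ₄_nat_one_mod_four h1]
      simp only [one_pow, mul_one]
    · rw [hiff, zeroCount_odd_eq_iff hq (by omega) hK, quadraticChar_neg_one hr, ZMod.card,
        ZMod.χ₄_nat_three_mod_four h3]
      -- With m = 2k + 1 the power of ι is (-1)^(3(k+1)), which is η(-1)^(k+1) because η(-1) = -1
      -- when q ≡ 3 mod 4.
      have hI : Complex.I ^ (3 * (2 * k + 1) + 3) = ((-1 : ℤ) : ℂ) ^ (k + 1) := by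
        rw [show 3 * (2 * k + 1) + 3 = 2 * (3 * (k + 1)) by ring, pow_mul, Complex.I_sq, pow_mul]
        norm_num
      rw [hI]
      refine and_congr_right fun _ => exists_congr fun x₀ => and_congr_right fun _ => ?_
      rw [mul_comm, ← mul_assoc, ← Int.cast_inj (α := ℂ)]
      push_cast
      rfl
  · intro he a b
    obtain ⟨k, rfl⟩ : ∃ k, m = 2 * (k + 1) := by
      obtain ⟨j, rfl⟩ := he
      exact ⟨j - 1, by omega⟩
    rw [hammingNorm_codeword_eq_iff hq hKpos hK, show (2 * (k + 1) - 1) / 2 = k by omega,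
      show 2 * (k + 1) - 1 = 2 * k + 1 by omega, Nat.mul_div_cancel_left _ two_pos]
    exact zeroCount_even_eq_iff hq hK a b
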